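/- **Setting.** Let $d\ge 0$, $d_3\ge 1$, and give $\mathbb{R}^{d\times d\times d_3}$ the Frobenius inner product and norm. For a tensor $\mathcal{T}$ let $\widetilde{\mathcal T}$ be its discrete Fourier transform along the third dimension, and let $\sigma_{1j}(\mathcal T)\ge\dots\ge\sigma_{dj}(\mathcal T)\ge 0$ be the singular values of the $j$-th frontal slice of $\widetilde{\mathcal T}$, $j=1,\dots,d_3$. A t-SVD of $\mathcal T$ is a factorization $\mathcal T=\mathcal U*\mathcal S*\mathcal V^{\mathsf T}$ (t-product) with real orthogonal tensors $\mathcal U,\mathcal V$ and a real f-diagonal tensor $\mathcal S$ with $\widetilde{\mathcal S}(i,i,j)=\sigma_{ij}(\mathcal T)$. **Objective.** Let $\rho:\mathbb{R}\to\mathbb{R}$ be nonnegative, continuous, concave and nondecreasing on $[0,\infty)$, and assume: (i) $\rho$ is even and $\rho(0)=0$; (ii) $\rho$ is nondecreasing on $[0,\infty)$; (iii) $x\mapsto\rho(x)/x$ is nonincreasing on $(0,\infty)$; (iv) $\rho$ is differentiable at every $t\neq0$, its subdifferential at $0$ is nonempty, and $\lim_{t\to0^+}\rho'(t)$ exists in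 $\mathbb{R}$; (v) $\rho(x)+\frac{\mu}{2}x^2$ is convex for some $\mu>0$. Put $$\rho(\mathcal{B})=\frac1{d_3}\sum_{i=1}^{d}\sum_{j=1}^{d_3}\rho(\sigma_{ij}(\mathcal{B})),\qquad F(\mathcal{B})=L_n(\mathcal{B})+\rho(\mathcal{B}),$$ where $L_n:\mathbb{R}^{d\times d\times d_3}\to\mathbb{R}$ is differentiable and its gradient $L_n'$ is Lipschitz continuous with constant $C_l>0$. **Algorithm.** Let $0<\alpha<1$, $\kappa>1$, $\bar\eta\in\mathbb{R}$. Let $(\mathcal{B}_k)_{k\ge0}$ be an infinite sequence generated as follows. Given $\mathcal{B}_k$ with singular values $\sigma_{ij,k}=\sigma_{ij}(\mathcal{B}_k)$, choose weights $w_{ij,k}\in\partial\rho(\sigma_{ij,k})$ with $\rho(x)\le\rho(\sigma_{ij,k})+w_{ij,k}(x-\sigma_{ij,k})$ for all $x\ge0$ (that is, $w_{ij,k}=\rho'(\sigma_{ij,k})$ if $\sigma_{ij,k}>0$ and $w_{ij,k}=\lim_{t\to0^+}\rho'(t)$ if $\sigma_{ij,k}=0$). Start from a trial value $\eta_k>0$,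 arbitrary for $k=0$; for $k\ge1$ it is either the Barzilai–Borwein value $$\frac{\langle \Delta_{1k},\Delta_{2k}\rangle}{\langle\Delta_{1k},\Delta_{1k}\rangle},\qquad \Delta_{1k}=\mathcal{B}_k-\mathcal{B}_{k-1},\quad \Delta_{2k}=L_n'(\mathcal{B}_k)-L_n'(\mathcal{B}_{k-1}),$$ or a safeguard value not exceeding $\bar\eta$. For the current $\eta_k$ compute a t-SVD $\mathcal{B}_k-\frac1{\eta_k}L_n'(\mathcal{B}_k)=\mathcal{U}*\mathcal{S}*\mathcal{V}^{\mathsf T}$ and the candidate $\mathcal{B}_{k+1}=\mathcal{U}*\mathcal{S}_k*\mathcal{V}^{\mathsf T}$, where $\mathcal{S}_k$ is f-diagonal with $\widetilde{\mathcal{S}_k}(i,i,j)=\big(\widetilde{\mathcal S}(i,i,j)-\frac{1}{\eta_k}w_{ij,k}\big)_+$. If the candidate satisfies $$F(\mathcal{B}_{k+1})+\frac{\alpha}{2}\eta_k\|\mathcal{B}_{k+1}-\mathcal{B}_k\|_F^2\le F(\mathcal{B}_k),$$ accept $\mathcal{B}_{k+1}$ and $\eta_k$; otherwise replace $\eta_k$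 by $\kappa\eta_k$ and compute the candidate again. **Theorem (local convergence).** Assume that the accepted parameters satisfy $\eta_k\ge C_l/(1-\alpha)$ for all $k>0$, and that $F$ is coercive, i.e. $F$ is bounded from below and $F(\mathcal{B})\to\infty$ as $\|\mathcal{B}\|_F\to\infty$. Then every accumulation point $\mathcal{B}^\star$ of $(\mathcal{B}_k)$ is a stationary point of $F$, i.e. $0\in\partial F(\mathcal{B}^\star)$ with $\partial F$ the Fréchet subdifferential: $$\liminf_{\mathcal{B}\to\mathcal{B}^\star,\ \mathcal{B}\neq\mathcal{B}^\star}\frac{F(\mathcal{B})-F(\mathcal{B}^\star)}{\|\mathcal{B}-\mathcal{B}^\star\|_F}\ge0 .$$ -/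

import Mathlib

open scoped BigOperators NNReal Topology

noncomputable section

namespace TubalRegression

/-- Real third-order tensors of size `d × d × d₃`, with the Frobenius inner product and norm.
The third (tubal) index is taken modulo `d₃`, so that the tubes carry circular convolution and the
discrete Fourier transform; `t : ZMod d₃` labels the frontal slice number `t + 1`. -/
abbrev Tensor (d d₃ : ℕ) [NeZero d₃] : Type :=
  EuclideanSpace ℝ (Fin d × Fin d × ZMod d₃)

variable {d d₃ : ℕ} [NeZero d₃]

/-- The `j`-th frontal slice of the tensor `fft(A, [], 3)`, i.e. the discrete Fourier transform of
all tubes of `A`: its `(i, l)` entry is `∑ t, exp (-2π√-1 j t / d₃) A(i, l, t)`. -/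
def fourierSlice (A : Tensor d d₃) (j : ZMod d₃) : Matrix (Fin d) (Fin d) ℂ :=
  Matrix.of fun i l => ZMod.dft (fun t : ZMod d₃ => ((A (i, l, t) : ℝ) : ℂ)) j

/-- The singular values `σ_{ij}` of a tensor in the Fourier domain: the `i`-th largest singular value
(with multiplicity) of the `j`-th frontal slice in the Fourier domain. -/
def sigma (A : Tensor d d₃) (i : Fin d) (j : ZMod d₃) : ℝ :=
  (Matrix.toEuclideanLin (fourierSlice A j)).singularValues (i : ℕ)

/-- The t-product: matrix multiplication with circular convolution of tubes. -/
def tProduct (A B : Tensor d d₃) : Tensor d d₃ :=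
  WithLp.toLp 2 fun p => ∑ l : Fin d, ∑ s : ZMod d₃, A (p.1, l, s) * B (l, p.2.1, p.2.2 - s)

/-- The transpose of a real tensor: transpose every frontal slice and reverse the order of the
slices `2, …, d₃`. -/
def tTranspose (A : Tensor d d₃) : Tensor d d₃ :=
  WithLp.toLp 2 fun p => A (p.2.1, p.1, -p.2.2)

/-- The identity tensor: first frontal slice the identity matrix, all others zero. -/
def tOne (d d₃ : ℕ) [NeZero d₃] : Tensor d d₃ :=
  WithLp.toLp 2 fun p => if p.1 = p.2.1 ∧ p.2.2 = 0 then 1 else 0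

/-- Orthogonal tensors. -/
def IsOrthogonal (A : Tensor d d₃) : Prop :=
  tProduct (tTranspose A) A = tOne d d₃ ∧ tProduct A (tTranspose A) = tOne d d₃

/-- f-diagonal tensors: every frontal slice is diagonal. -/
def IsFDiagonal (A : Tensor d d₃) : Prop :=
  ∀ (i l : Fin d) (t : ZMod d₃), i ≠ l → A (i, l, t) = 0

/-- `T = U * S * Vᵀ` is a t-SVD of `T`: `U`, `V` are orthogonal, `S` is f-diagonal, and in the
Fourier domain the diagonal of the `j`-th slice of `S` consists of the singular values
`σ_{1j} ≥ ⋯ ≥ σ_{dj} ≥ 0`. -/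
structure IsTSVD (T U S V : Tensor d d₃) : Prop where
  orthogonal_left : IsOrthogonal U
  orthogonal_right : IsOrthogonal V
  fdiagonal : IsFDiagonal S
  factorization : T = tProduct (tProduct U S) (tTranspose V)
  diagonal : ∀ (i : Fin d) (j : ZMod d₃), fourierSlice S j i i = ((sigma T i j : ℝ) : ℂ)

/-- `S' = ifft((S̃ - τ W)₊, [], 3)`: soft thresholding, with the weights `τ w_{ij}`, of the diagonal
of an f-diagonal tensor in the Fourier domain. -/
def IsWeightedThreshold (S : Tensor d d₃) (τ : ℝ) (W : Fin d → ZMod d₃ → ℝ) (S' : Tensor d d₃) :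
    Prop :=
  IsFDiagonal S' ∧ ∀ (i : Fin d) (j : ZMod d₃),
    fourierSlice S' j i i = ((max ((fourierSlice S j i i).re - τ * W i j) 0 : ℝ) : ℂ)

/-- `Y` is obtained from `G` by the weighted tensor singular value thresholding operator with
threshold parameter `τ` and weights `W`, i.e. `Y = U * S_{W,τ} * Vᵀ` for a t-SVD
`G = U * S * Vᵀ`. -/
def IsWTSVT (G : Tensor d d₃) (τ : ℝ) (W : Fin d → ZMod d₃ → ℝ) (Y : Tensor d d₃) : Prop :=
  ∃ U S V S' : Tensor d d₃, IsTSVD G U S V ∧ IsWeightedThreshold S τ W S' ∧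
    Y = tProduct (tProduct U S') (tTranspose V)

/-- The tensor regularizer induced by a univariate penalty `ρ`:
`(1/d₃) ∑_{i,j} ρ (σ_{ij})`. -/
def tensorPenalty (ρ : ℝ → ℝ) (A : Tensor d d₃) : ℝ :=
  (1 / (d₃ : ℝ)) * ∑ i : Fin d, ∑ j : ZMod d₃, ρ (sigma A i j)

/-- The objective function `F = L + ρ`. -/
def objective (L : Tensor d d₃ → ℝ) (ρ : ℝ → ℝ) (A : Tensor d d₃) : ℝ :=
  L A + tensorPenalty ρ A

/-- The Fréchet (regular) subdifferential of a real-valued function on a Hilbert space. -/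
def frechetSubdiff {E : Type*} [NormedAddCommGroup E] [InnerProductSpace ℝ E]
    (f : E → ℝ) (x : E) : Set E :=
  {v | ∀ ε > 0, ∀ᶠ y in 𝓝 x, f x + inner ℝ v (y - x) - ε * ‖y - x‖ ≤ f y}

/-- Stationary points: `0 ∈ ∂f(x)`. With the Fréchet subdifferential, the smallest of the usual ones
(it is contained in the limiting and in the Clarke subdifferential). -/
def IsStationaryPoint {E : Type*} [NormedAddCommGroup E] [InnerProductSpace ℝ E]
    (f : E → ℝ) (x : E) : Prop :=
  (0 : E) ∈ frechetSubdiff f x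

/-- Coercivity: bounded below, and `f x → ∞` as `‖x‖ → ∞`. -/
def IsCoerciveFun {E : Type*} [NormedAddCommGroup E] (f : E → ℝ) : Prop :=
  BddBelow (Set.range f) ∧ Filter.Tendsto f (Bornology.cobounded E) Filter.atTop

/-- The standing conditions on the univariate function that generates the regularizer: on the
nonnegative half-line it is nonnegative, continuous, concave and increasing. -/
structure IsPenalty (ρ : ℝ → ℝ) : Prop where
  nonneg : ∀ x, 0 ≤ x → 0 ≤ ρ x
  continuousOn : ContinuousOn ρ (Set.Ici 0)
  concaveOn : ConcaveOn ℝ (Set.Ici 0) ρ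
  monotoneOn : MonotoneOn ρ (Set.Ici 0)

/-- The regularity assumption on the univariate penalty: symmetric and zero at zero, nondecreasing on
`x ≥ 0`, `ρ x / x` nonincreasing on `x > 0`, differentiable off zero with a finite limit of the
derivative at `0+` and subdifferentiable at `0`, and weakly convex. -/
structure PenaltyAssumption (ρ : ℝ → ℝ) : Prop where
  symm : ∀ x, ρ (-x) = ρ x
  zero : ρ 0 = 0
  monotoneOn : MonotoneOn ρ (Set.Ici 0)
  ratio_antitoneOn : AntitoneOn (fun x => ρ x / x) (Set.Ioi 0)
  differentiableAt : ∀ x, x ≠ 0 → DifferentiableAt ℝ ρ x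
  subdiff_zero : (frechetSubdiff ρ 0).Nonempty
  deriv_limit : ∃ C : ℝ, Filter.Tendsto (deriv ρ) (𝓝[>] 0) (𝓝 C)
  weaklyConvex : ∃ μ : ℝ, 0 < μ ∧ ConvexOn ℝ Set.univ (fun x => ρ x + μ / 2 * x ^ 2)

/-- `w` is an admissible reweighting weight for the singular value `s`: a subgradient of `ρ` at `s`
whose linearization majorizes `ρ` on the nonnegative half-line. Under the assumptions on the penalty
this means `w = ρ'(s)` for `s > 0` and `w = lim_{t → 0+} ρ'(t)` for `s = 0`. -/
def IsWeight (ρ : ℝ → ℝ) (s w : ℝ) : Prop :=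
  w ∈ frechetSubdiff ρ s ∧ ∀ x, 0 ≤ x → ρ x ≤ ρ s + w * (x - s)

/-- `Y` is a result of one update from the iterate `A` with weights `W` and step parameter `η`:
weighted singular value thresholding of `A - L'(A)/η` with parameter `1/η`. -/
def IsUpdate (L : Tensor d d₃ → ℝ) (W : Fin d → ZMod d₃ → ℝ) (η : ℝ) (A Y : Tensor d d₃) : Prop :=
  IsWTSVT (A - (1 / η) • gradient L A) (1 / η) W Y

/-- The monotone search criterion for the move from `A` to `Y` with step parameter `η`. -/
def SearchCriterion (L : Tensor d d₃ → ℝ) (ρ : ℝ → ℝ) (α η : ℝ) (A Y : Tensor d d₃) : Prop :=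
  objective L ρ Y + α / 2 * η * ‖Y - A‖ ^ 2 ≤ objective L ρ A

/-- The Barzilai–Borwein value `⟨Δ₁, Δ₂⟩ / ⟨Δ₁, Δ₁⟩`, with `Δ₁` the difference of the current iterate
`A` and the previous iterate `A'`, and `Δ₂` the difference of the gradients. -/
def barzilaiBorwein (L : Tensor d d₃ → ℝ) (A' A : Tensor d d₃) : ℝ :=
  inner ℝ (A - A') (gradient L A - gradient L A') / inner ℝ (A - A') (A - A')

/-- The step parameter accepted at iteration `k` by backtracking: the initial value `η₀ k`, increased
`m k` times by the factor `κ`. -/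
def stepParam (κ : ℝ) (η₀ : ℕ → ℝ) (m : ℕ → ℕ) (k : ℕ) : ℝ := κ ^ m k * η₀ k

/-- `B`, `W`, `η₀`, `m` is an (infinite) run of the iteratively reweighted algorithm with
backtracking: `B k` are the iterates, `W k` the weights, `η₀ k` the initial trial step parameters, and
`m k` the number of backtracking steps in iteration `k`. From the second iteration on, the trial
parameter is initialized either by the Barzilai–Borwein value or by a safeguard value at most `c`. -/
structure IsAlgorithmRun (L : Tensor d d₃ → ℝ) (ρ : ℝ → ℝ) (α κ c : ℝ)
    (B : ℕ → Tensor d d₃) (W : ℕ → Fin d → ZMod d₃ → ℝ) (η₀ : ℕ → ℝ) (m : ℕ → ℕ) : Prop where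
  weights : ∀ k i j, IsWeight ρ (sigma (B k) i j) (W k i j)
  init_pos : ∀ k, 0 < η₀ k
  init : ∀ k, η₀ (k + 1) = barzilaiBorwein L (B k) (B (k + 1)) ∨ η₀ (k + 1) ≤ c
  /-- The trials before the last one violate the search criterion. -/
  rejected : ∀ k, ∀ n < m k, ∃ Y, IsUpdate L (W k) (κ ^ n * η₀ k) (B k) Y ∧
    ¬ SearchCriterion L ρ α (κ ^ n * η₀ k) (B k) Y
  /-- The next iterate is the first trial that satisfies the search criterion. -/
  update : ∀ k, IsUpdate L (W k) (stepParam κ η₀ m k) (B k) (B (k + 1))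
  criterion : ∀ k, SearchCriterion L ρ α (stepParam κ η₀ m k) (B k) (B (k + 1))

end TubalRegression

end

/-!
The discrete Fourier transform along the tubes turns t-products into products of frontal slices and
preserves the Frobenius norm up to the factor `d₃`. Slice by slice, von Neumann's trace inequality
therefore shows that the singular values are nonexpansive functions of the tensor, and that one
update minimizes the quadratic model of `L` plus the weighted tubal nuclear norm; the weights that
come from a concave majorant of `ρ` are ordered oppositely to the singular values, as this requires.

At the singular values of the current iterate `A`, the weighted nuclear norm majorizes the
regularizer up to a constant, and by weak convexity it minorizes it up to a multiple of `‖X - A‖²`.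
With the minimality of the new iterate `Y`, this gives for all `X`
`P Y - ⟪∇L A, X - Y⟫ - (η + μ) / 2 * ‖X - A‖² ≤ P X`, where `P` is the regularizer. Majorization and
the descent lemma also show that large step parameters pass the search criterion, so the accepted
ones stay bounded. The objective decreases along the run and has a cluster value at an accumulation
point, hence converges, which forces successive iterates together. So `A` and `Y` may both be sent
to the accumulation point `B⋆` in the inequality above, which makes `-∇L B⋆` a Fréchet subgradient
of `P` at `B⋆`.
-/

namespace TubalRegression

section SingularValueDecomposition

open Matrix
open scoped Matrix.Norms.Frobenius

variable {n 𝕜 : Type*} [Fintype n] [DecidableEq n] [RCLike 𝕜]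

/-- By Birkhoff's theorem it suffices to consider permutation matrices, for which this is the
rearrangement inequality. -/
theorem dotProduct_mulVec_le_of_mem_doublyStochastic {R : Type*} [Field R] [LinearOrder R]
    [IsStrictOrderedRing R] {a b : n → R} (hab : Monovary a b) {M : Matrix n n R}
    (hM : M ∈ doublyStochastic R n) : a ⬝ᵥ (M *ᵥ b) ≤ a ⬝ᵥ b := by
  have hconv : Convex R {M : Matrix n n R | a ⬝ᵥ (M *ᵥ b) ≤ a ⬝ᵥ b} :=
    convex_halfSpace_le
      ⟨fun M N => by rw [add_mulVec, dotProduct_add],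
        fun c M => by rw [smul_mulVec, dotProduct_smul]⟩ _
  rw [← SetLike.mem_coe, doublyStochastic_eq_convexHull_permMatrix] at hM
  refine convexHull_min ?_ hconv hM
  rintro _ ⟨σ, rfl⟩
  rw [Set.mem_ofPred_eq, permMatrix_mulVec]
  exact hab.sum_mul_comp_perm_le_sum_mul

theorem norm_sq_mem_doublyStochastic {P : Matrix n n 𝕜} (hP : P ∈ unitaryGroup n 𝕜) :
    (of fun i j => ‖P i j‖ ^ 2) ∈ doublyStochastic ℝ n := by
  refine mem_doublyStochastic_iff_sum.2 ⟨fun i j => by simp, fun i => ?_, fun j => ?_⟩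
  · have h := congr_fun₂ (mem_unitaryGroup_iff.1 hP) i i
    simp only [mul_apply, star_apply, RCLike.star_def, RCLike.mul_conj, one_apply_eq] at h
    exact_mod_cast h
  · have h := congr_fun₂ (mem_unitaryGroup_iff'.1 hP) j j
    simp only [mul_apply, star_apply, RCLike.star_def, RCLike.conj_mul, one_apply_eq] at h
    exact_mod_cast h

theorem frobenius_norm_sq_eq_sum {m l α : Type*} [Fintype m] [Fintype l]
    [SeminormedAddCommGroup α] (A : Matrix m l α) : ‖A‖ ^ 2 = ∑ i, ∑ j, ‖A i j‖ ^ 2 := by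
  have h : 0 ≤ ∑ i, ∑ j, ‖A i j‖ ^ 2 := by positivity
  simp only [frobenius_norm_def, Real.rpow_two, ← Real.sqrt_eq_rpow, Real.sq_sqrt h]

theorem frobenius_norm_sq_eq_re_trace {m l : Type*} [Fintype m] [Fintype l]
    (A : Matrix m l 𝕜) : ‖A‖ ^ 2 = RCLike.re (Aᴴ * A).trace := by
  simp only [frobenius_norm_sq_eq_sum, trace, diag, mul_apply, conjTranspose_apply,
    RCLike.star_def, RCLike.conj_mul, map_sum]
  rw [Finset.sum_comm]
  norm_cast

theorem frobenius_norm_sub_sq {m l : Type*} [Fintype m] [Fintype l] (A B : Matrix m l 𝕜) :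
    ‖A - B‖ ^ 2 = ‖A‖ ^ 2 - 2 * RCLike.re (Aᴴ * B).trace + ‖B‖ ^ 2 := by
  have hcomm : RCLike.re (Bᴴ * A).trace = RCLike.re (Aᴴ * B).trace := by
    rw [← RCLike.conj_re, ← RCLike.star_def, ← trace_conjTranspose, conjTranspose_mul,
      conjTranspose_conjTranspose]
  simp only [frobenius_norm_sq_eq_re_trace, conjTranspose_sub, Matrix.sub_mul, Matrix.mul_sub,
    trace_sub, map_sub]
  linarith

/-- `A = U * diagonal s * Vᴴ` with unitary `U` and `V`: a singular value decomposition of `A`,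
except that `s` is not required to be nonnegative or sorted. -/
structure IsSVD (A U : Matrix n n 𝕜) (s : n → ℝ) (V : Matrix n n 𝕜) : Prop where
  left : U ∈ unitaryGroup n 𝕜
  right : V ∈ unitaryGroup n 𝕜
  eq : A = U * diagonal (fun i => (s i : 𝕜)) * Vᴴ

namespace IsSVD

variable {A B U V U' V' : Matrix n n 𝕜} {a b : n → ℝ}

theorem sub (hA : IsSVD A U a V) (hB : IsSVD B U b V) : IsSVD (A - B) U (a - b) V where
  left := hA.left
  right := hA.right
  eq := by
    rw [hA.eq, hB.eq, ← Matrix.sub_mul, ← Matrix.mul_sub, diagonal_sub]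
    simp only [Pi.sub_apply, RCLike.ofReal_sub]

theorem trace_conjTranspose_mul (hA : IsSVD A U a V) (hB : IsSVD B U' b V') :
    (Aᴴ * B).trace =
      ∑ i, ∑ j, ((a i * b j : ℝ) : 𝕜) * ((Uᴴ * U') i j * star ((Vᴴ * V') i j)) := by
  have hcycle : (Aᴴ * B).trace = (diagonal (fun i => (a i : 𝕜)) * (Uᴴ * U') *
      diagonal (fun i => (b i : 𝕜)) * (Vᴴ * V')ᴴ).trace := by
    have hstar : star (fun i => (a i : 𝕜)) = fun i => (a i : 𝕜) := by ext; simp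
    rw [hA.eq, hB.eq]
    simp only [conjTranspose_mul, conjTranspose_conjTranspose, diagonal_conjTranspose, hstar,
      Matrix.mul_assoc]
    rw [trace_mul_comm]
    simp only [Matrix.mul_assoc]
  rw [hcycle]
  simp only [trace, diag, mul_apply (N := (Vᴴ * V')ᴴ)]
  refine Finset.sum_congr rfl fun i _ => Finset.sum_congr rfl fun j _ => ?_
  rw [mul_diagonal, diagonal_mul, conjTranspose_apply, RCLike.ofReal_mul]
  ring

theorem frobenius_norm_sq (hA : IsSVD A U a V) : ‖A‖ ^ 2 = ∑ i, a i ^ 2 := by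
  have hU : Uᴴ * U = 1 := mem_unitaryGroup_iff'.1 hA.left
  have hV : Vᴴ * V = 1 := mem_unitaryGroup_iff'.1 hA.right
  rw [frobenius_norm_sq_eq_re_trace, hA.trace_conjTranspose_mul hA, hU, hV, map_sum]
  refine Finset.sum_congr rfl fun i _ => ?_
  rw [Finset.sum_eq_single i (fun j _ hj => by simp [one_apply_ne' hj]) (by simp)]
  simp [sq]

/-- Von Neumann's trace inequality. AM-GM on each entry of `Uᴴ * U'` and `Vᴴ * V'` replaces these
unitary matrices by doubly stochastic ones. -/
theorem re_trace_conjTranspose_mul_le (hA : IsSVD A U a V) (hB : IsSVD B U' b V')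
    (hab : Monovary a b) (ha : 0 ≤ a) (hb : 0 ≤ b) :
    RCLike.re (Aᴴ * B).trace ≤ a ⬝ᵥ b := by
  set P := Uᴴ * U'
  set Q := Vᴴ * V'
  have hP := dotProduct_mulVec_le_of_mem_doublyStochastic hab
    (norm_sq_mem_doublyStochastic (mul_mem (Unitary.star_mem hA.left) hB.left : P ∈ _))
  have hQ := dotProduct_mulVec_le_of_mem_doublyStochastic hab
    (norm_sq_mem_doublyStochastic (mul_mem (Unitary.star_mem hA.right) hB.right : Q ∈ _))
  have hPQ (i j : n) : RCLike.re (P i j * star (Q i j)) ≤ (‖P i j‖ ^ 2 + ‖Q i j‖ ^ 2) / 2 :=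
    calc RCLike.re (P i j * star (Q i j)) ≤ ‖P i j‖ * ‖Q i j‖ := by
          simpa only [norm_mul, norm_star] using RCLike.re_le_norm (P i j * star (Q i j))
      _ ≤ (‖P i j‖ ^ 2 + ‖Q i j‖ ^ 2) / 2 := by linarith [two_mul_le_add_sq ‖P i j‖ ‖Q i j‖]
  calc RCLike.re (Aᴴ * B).trace
      = ∑ i, ∑ j, a i * b j * RCLike.re (P i j * star (Q i j)) := by
        simp only [hA.trace_conjTranspose_mul hB, map_sum, RCLike.re_ofReal_mul, P, Q]
    _ ≤ ∑ i, ∑ j, a i * b j * ((‖P i j‖ ^ 2 + ‖Q i j‖ ^ 2) / 2) := by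
        gcongr with i _ j _
        · exact mul_nonneg (ha i) (hb j)
        · exact hPQ i j
    _ = (a ⬝ᵥ ((of fun i j => ‖P i j‖ ^ 2) *ᵥ b) +
          a ⬝ᵥ ((of fun i j => ‖Q i j‖ ^ 2) *ᵥ b)) / 2 := by
        simp only [dotProduct, mulVec, of_apply, Finset.mul_sum, ← Finset.sum_add_distrib,
          Finset.sum_div]
        congr! 2
        ring
    _ ≤ a ⬝ᵥ b := by linarith

theorem sum_sub_sq_le (hA : IsSVD A U a V) (hB : IsSVD B U' b V') (hab : Monovary a b)
    (ha : 0 ≤ a) (hb : 0 ≤ b) : ∑ i, (a i - b i) ^ 2 ≤ ‖A - B‖ ^ 2 :=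
  calc ∑ i, (a i - b i) ^ 2 = ∑ i, a i ^ 2 - 2 * (a ⬝ᵥ b) + ∑ i, b i ^ 2 := by
        simp only [sub_sq, Finset.sum_add_distrib, Finset.sum_sub_distrib, dotProduct,
          Finset.mul_sum, mul_assoc]
    _ ≤ ‖A - B‖ ^ 2 := by
        rw [frobenius_norm_sub_sq, hA.frobenius_norm_sq, hB.frobenius_norm_sq]
        linarith [hA.re_trace_conjTranspose_mul_le hB hab ha hb]

end IsSVD

section Existence

variable {E F : Type*} [NormedAddCommGroup E] [InnerProductSpace 𝕜 E] [FiniteDimensional 𝕜 E]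
  [NormedAddCommGroup F] [InnerProductSpace 𝕜 F] [FiniteDimensional 𝕜 F] {d : ℕ}

theorem inner_apply_eigenvectorBasis (T : E →ₗ[𝕜] F) (hE : Module.finrank 𝕜 E = d)
    (i j : Fin d) :
    inner 𝕜 (T (T.isSymmetric_adjoint_comp_self.eigenvectorBasis hE i))
      (T (T.isSymmetric_adjoint_comp_self.eigenvectorBasis hE j)) =
        if i = j then (T.singularValues i : 𝕜) ^ 2 else 0 := by
  rw [← LinearMap.adjoint_inner_right, ← LinearMap.comp_apply,
    T.isSymmetric_adjoint_comp_self.apply_eigenvectorBasis hE, inner_smul_right,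
    orthonormal_iff_ite.1 (OrthonormalBasis.orthonormal _), ← T.sq_singularValues_fin hE]
  split_ifs with h
  · simp [h]
  · simp

theorem exists_orthonormalBasis_apply_eq_singularValues_smul (T : E →ₗ[𝕜] F)
    (hE : Module.finrank 𝕜 E = d) (hF : Module.finrank 𝕜 F = d) :
    ∃ (u : OrthonormalBasis (Fin d) 𝕜 F) (v : OrthonormalBasis (Fin d) 𝕜 E),
      ∀ i, T (v i) = (T.singularValues i : 𝕜) • u i := by
  set v := T.isSymmetric_adjoint_comp_self.eigenvectorBasis hE
  set s : Fin d → 𝕜 := fun i => T.singularValues i with hs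
  have hinner : ∀ i j, inner 𝕜 (T (v i)) (T (v j)) = if i = j then s i ^ 2 else 0 :=
    inner_apply_eigenvectorBasis T hE
  have horth : Orthonormal 𝕜 ({i | s i ≠ 0}.domRestrict fun i => (s i)⁻¹ • T (v i)) := by
    rw [orthonormal_iff_ite]
    rintro ⟨i, hi : s i ≠ 0⟩ ⟨j, hj⟩
    simp only [Set.domRestrict_apply, inner_smul_left, inner_smul_right, hinner, Subtype.mk.injEq]
    split_ifs with h
    · subst h
      simp only [map_inv₀, hs, RCLike.conj_ofReal] at hi ⊢
      field_simp
    · simp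
  obtain ⟨u, hu⟩ := horth.exists_orthonormalBasis_extension_of_card_eq (by simpa using hF)
  refine ⟨u, v, fun i => ?_⟩
  rcases eq_or_ne (s i) 0 with hi | hi
  · have hzero : T (v i) = 0 := by simpa [hi] using hinner i i
    rw [hzero, show (T.singularValues i : 𝕜) = 0 from hi, zero_smul]
  · rw [hu i hi, smul_inv_smul₀ hi]

end Existence

variable {d : ℕ}

theorem exists_isSVD (A : Matrix (Fin d) (Fin d) 𝕜) :
    ∃ U V, IsSVD A U (fun i => (toEuclideanLin A).singularValues i) V := by
  obtain ⟨u, v, huv⟩ := exists_orthonormalBasis_apply_eq_singularValues_smul (toEuclideanLin A)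
    finrank_euclideanSpace_fin finrank_euclideanSpace_fin
  let e := EuclideanSpace.basisFun (Fin d) 𝕜
  set V := e.toBasis.toMatrix v
  have hV : V ∈ unitaryGroup (Fin d) 𝕜 := e.toMatrix_orthonormalBasis_mem_unitary v
  refine ⟨e.toBasis.toMatrix u, V, e.toMatrix_orthonormalBasis_mem_unitary u, hV, ?_⟩
  have hAV : A * V = e.toBasis.toMatrix u *
      diagonal fun i : Fin d => ((toEuclideanLin A).singularValues i : 𝕜) := by
    ext i k
    rw [mul_diagonal]
    simpa [V, e, Module.Basis.toMatrix_apply, mul_apply, mulVec, dotProduct, toLpLin_apply,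
      RCLike.real_smul_eq_coe_mul, mul_comm]
      using congrArg (fun x : EuclideanSpace 𝕜 (Fin d) => x i) (huv k)
  rw [← hAV, Matrix.mul_assoc, ← star_eq_conjTranspose, mem_unitaryGroup_iff.1 hV, Matrix.mul_one]

theorem antitone_singularValues (A : Matrix (Fin d) (Fin d) 𝕜) :
    Antitone fun i : Fin d => (toEuclideanLin A).singularValues i :=
  (toEuclideanLin A).singularValues_antitone.comp_monotone Fin.val_strictMono.monotone

theorem IsSVD.singularValues_eq {A U V : Matrix (Fin d) (Fin d) 𝕜} {s : Fin d → ℝ}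
    (hA : IsSVD A U s V) (hs : Antitone s) (hs₀ : 0 ≤ s) (i : Fin d) :
    (toEuclideanLin A).singularValues i = s i := by
  obtain ⟨_, _, hA'⟩ := exists_isSVD A
  have hle := hA'.sum_sub_sq_le hA
    ((antitone_singularValues A).monovary hs)
    (fun _ => LinearMap.singularValues_nonneg _ _) hs₀
  rw [sub_self, norm_zero, zero_pow two_ne_zero] at hle
  have hzero := (Finset.sum_eq_zero_iff_of_nonneg fun i _ => sq_nonneg _).1
    (hle.antisymm (Finset.sum_nonneg fun i _ => sq_nonneg _)) i (Finset.mem_univ i)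
  exact sub_eq_zero.1 (pow_eq_zero_iff two_ne_zero |>.1 hzero)

theorem softThreshold_le (g t : ℝ) {x : ℝ} (hx : 0 ≤ x) :
    1 / 2 * (max (g - t) 0 - g) ^ 2 + t * max (g - t) 0 ≤ 1 / 2 * (x - g) ^ 2 + t * x := by
  rcases le_total (g - t) 0 with h | h
  · rw [max_eq_right h]
    nlinarith [mul_nonneg hx (sub_nonneg.2 h), sq_nonneg x]
  · rw [max_eq_left h]
    nlinarith [sq_nonneg (x - g + t)]

theorem IsSVD.isMinOn_of_softThreshold {G Y U V : Matrix (Fin d) (Fin d) 𝕜} {g w : Fin d → ℝ}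
    (hG : IsSVD G U g V) (hg : Antitone g) (hg₀ : 0 ≤ g) (hgw : Antitone (g - w))
    (hY : IsSVD Y U (fun i => max (g i - w i) 0) V) :
    IsMinOn (fun X => 1 / 2 * ‖X - G‖ ^ 2 + ∑ i : Fin d, w i * (toEuclideanLin X).singularValues i)
      Set.univ Y := by
  rw [isMinOn_univ_iff]
  intro X
  obtain ⟨_, _, hX⟩ := exists_isSVD X
  have hYval := hY.singularValues_eq (fun i j hij => max_le_max_right 0 (hgw hij))
    fun i => le_max_right _ _
  have hXG := hX.sum_sub_sq_le hG
    ((antitone_singularValues X).monovary hg)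
    (fun _ => LinearMap.singularValues_nonneg _ _) hg₀
  calc 1 / 2 * ‖Y - G‖ ^ 2 + ∑ i : Fin d, w i * (toEuclideanLin Y).singularValues i
      = ∑ i, (1 / 2 * (max (g i - w i) 0 - g i) ^ 2 + w i * max (g i - w i) 0) := by
        simp only [(hY.sub hG).frobenius_norm_sq, hYval, Pi.sub_apply, Finset.mul_sum,
          Finset.sum_add_distrib]
    _ ≤ ∑ i : Fin d, (1 / 2 * ((toEuclideanLin X).singularValues i - g i) ^ 2 +
          w i * (toEuclideanLin X).singularValues i) :=
        Finset.sum_le_sum fun i _ => softThreshold_le _ _ (LinearMap.singularValues_nonneg _ _)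
    _ ≤ 1 / 2 * ‖X - G‖ ^ 2 + ∑ i : Fin d, w i * (toEuclideanLin X).singularValues i := by
        rw [Finset.sum_add_distrib, ← Finset.mul_sum]
        gcongr

end SingularValueDecomposition

section FourierDomain

open Matrix
open scoped Matrix.Norms.Frobenius

variable {d d₃ : ℕ} [NeZero d₃]

theorem fourierSlice_apply (A : Tensor d d₃) (j : ZMod d₃) (i l : Fin d) :
    fourierSlice A j i l = ∑ t : ZMod d₃, ZMod.stdAddChar (-(t * j)) * (A (i, l, t) : ℂ) := by
  simp [fourierSlice, ZMod.dft_apply]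

theorem fourierSlice_sub (A B : Tensor d d₃) (j : ZMod d₃) :
    fourierSlice (A - B) j = fourierSlice A j - fourierSlice B j := by
  ext i l
  simp only [fourierSlice_apply, Matrix.sub_apply, PiLp.sub_apply, Complex.ofReal_sub, mul_sub,
    Finset.sum_sub_distrib]

theorem sum_norm_sq_dft {N : ℕ} [NeZero N] (Φ : ZMod N → ℂ) :
    ∑ k, ‖ZMod.dft Φ k‖ ^ 2 = N * ∑ t, ‖Φ t‖ ^ 2 := by
  have hinv (t : ZMod N) : ∑ k, ZMod.stdAddChar (t * k) * ZMod.dft Φ k = N * Φ t := by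
    simpa [ZMod.dft_apply (ZMod.dft Φ), mul_comm] using congrFun (ZMod.dft_dft Φ) (-t)
  have hconj (k : ZMod N) :
      starRingEnd ℂ (ZMod.dft Φ k) = ∑ t, starRingEnd ℂ (Φ t) * ZMod.stdAddChar (t * k) := by
    simp only [ZMod.dft_apply, smul_eq_mul, map_sum, map_mul, ← AddChar.map_neg_eq_conj, neg_neg,
      mul_comm]
  rw [← Complex.ofReal_inj]
  push_cast
  calc ∑ k, (‖ZMod.dft Φ k‖ : ℂ) ^ 2
      = ∑ k, ∑ t, starRingEnd ℂ (Φ t) * (ZMod.stdAddChar (t * k) * ZMod.dft Φ k) := by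
        simp only [← Complex.conj_mul', hconj, Finset.sum_mul, mul_assoc]
    _ = ∑ t, starRingEnd ℂ (Φ t) * (N * Φ t) := by
        rw [Finset.sum_comm]
        simp only [← Finset.mul_sum, hinv]
    _ = N * ∑ t, (‖Φ t‖ : ℂ) ^ 2 := by
        simp only [mul_left_comm _ (N : ℂ), Complex.conj_mul', Finset.mul_sum]

theorem norm_sq_eq_sum_norm_sq_fourierSlice (A : Tensor d d₃) :
    ‖A‖ ^ 2 = 1 / (d₃ : ℝ) * ∑ j, ‖fourierSlice A j‖ ^ 2 := by
  have htube (i l : Fin d) :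
      ∑ j, ‖fourierSlice A j i l‖ ^ 2 = d₃ * ∑ t, ‖A (i, l, t)‖ ^ 2 := by
    simpa [fourierSlice] using sum_norm_sq_dft fun t => (A (i, l, t) : ℂ)
  have hsum : ∑ j, ‖fourierSlice A j‖ ^ 2 = d₃ * ‖A‖ ^ 2 := by
    simp only [frobenius_norm_sq_eq_sum, EuclideanSpace.norm_sq_eq, Fintype.sum_prod_type,
      Finset.mul_sum _ _ (d₃ : ℝ)]
    rw [Finset.sum_comm]
    refine Finset.sum_congr rfl fun i _ => ?_
    rw [Finset.sum_comm]
    exact Finset.sum_congr rfl fun l _ => by rw [htube, Finset.mul_sum]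
  rw [hsum, one_div, inv_mul_cancel_left₀ (Nat.cast_ne_zero.2 (NeZero.ne d₃))]

theorem fourierSlice_tProduct (A B : Tensor d d₃) (j : ZMod d₃) :
    fourierSlice (tProduct A B) j = fourierSlice A j * fourierSlice B j := by
  ext i m
  have hchar (s t : ZMod d₃) : (ZMod.stdAddChar (-(t * j)) : ℂ) =
      ZMod.stdAddChar (-(s * j)) * ZMod.stdAddChar (-((t - s) * j)) := by
    rw [← AddChar.map_add_eq_mul]
    ring_nf
  simp only [mul_apply, fourierSlice_apply, tProduct, Complex.ofReal_sum, Complex.ofReal_mul,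
    Finset.mul_sum, Finset.sum_mul]
  rw [Finset.sum_comm]
  refine Finset.sum_congr rfl fun l _ => ?_
  rw [Finset.sum_comm]
  conv_rhs => rw [Finset.sum_comm]
  refine Finset.sum_congr rfl fun s _ => Fintype.sum_equiv (Equiv.subRight s) _ _ fun t => ?_
  rw [Equiv.subRight_apply, hchar s t]
  ring

theorem fourierSlice_tTranspose (A : Tensor d d₃) (j : ZMod d₃) :
    fourierSlice (tTranspose A) j = (fourierSlice A j)ᴴ := by
  ext i l
  simp only [conjTranspose_apply, fourierSlice_apply, tTranspose, Complex.star_def, map_sum,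
    map_mul, Complex.conj_ofReal, ← AddChar.map_neg_eq_conj, neg_neg]
  exact Fintype.sum_equiv (Equiv.neg _) _ _ fun t => by simp

theorem fourierSlice_tOne (j : ZMod d₃) : fourierSlice (tOne d d₃) j = 1 := by
  ext i l
  rw [fourierSlice_apply, Finset.sum_eq_single 0]
  · by_cases h : i = l <;> simp [tOne, one_apply, h]
  · intro t _ ht
    simp [tOne, ht]
  · simp

theorem IsOrthogonal.fourierSlice_mem_unitaryGroup {U : Tensor d d₃} (hU : IsOrthogonal U)
    (j : ZMod d₃) : fourierSlice U j ∈ unitaryGroup (Fin d) ℂ := by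
  rw [mem_unitaryGroup_iff, star_eq_conjTranspose, ← fourierSlice_tTranspose,
    ← fourierSlice_tProduct, hU.2, fourierSlice_tOne]

theorem IsFDiagonal.fourierSlice_eq_diagonal {S : Tensor d d₃} (hS : IsFDiagonal S)
    (j : ZMod d₃) : fourierSlice S j = diagonal fun i => fourierSlice S j i i := by
  ext i l
  rcases eq_or_ne i l with rfl | h
  · rw [diagonal_apply_eq]
  · rw [diagonal_apply_ne _ h, fourierSlice_apply]
    simp [hS i l _ h]

theorem isSVD_fourierSlice {U S V : Tensor d d₃} (hU : IsOrthogonal U) (hV : IsOrthogonal V)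
    (hS : IsFDiagonal S) {s : Fin d → ℝ} {j : ZMod d₃}
    (hs : ∀ i, fourierSlice S j i i = (s i : ℂ)) :
    IsSVD (fourierSlice (tProduct (tProduct U S) (tTranspose V)) j) (fourierSlice U j) s
      (fourierSlice V j) where
  left := hU.fourierSlice_mem_unitaryGroup j
  right := hV.fourierSlice_mem_unitaryGroup j
  eq := by
    rw [fourierSlice_tProduct, fourierSlice_tProduct, fourierSlice_tTranspose,
      hS.fourierSlice_eq_diagonal j]
    simp only [hs, Complex.coe_algebraMap]

theorem sigma_nonneg (A : Tensor d d₃) (i : Fin d) (j : ZMod d₃) : 0 ≤ sigma A i j :=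
  LinearMap.singularValues_nonneg _ _

theorem sigma_antitone (A : Tensor d d₃) (j : ZMod d₃) : Antitone fun i => sigma A i j :=
  antitone_singularValues _

theorem sum_sigma_sub_sq_le (A B : Tensor d d₃) :
    1 / (d₃ : ℝ) * ∑ i, ∑ j, (sigma A i j - sigma B i j) ^ 2 ≤ ‖A - B‖ ^ 2 := by
  rw [norm_sq_eq_sum_norm_sq_fourierSlice, Finset.sum_comm]
  gcongr with j
  obtain ⟨_, _, hA⟩ := exists_isSVD (fourierSlice A j)
  obtain ⟨_, _, hB⟩ := exists_isSVD (fourierSlice B j)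
  rw [fourierSlice_sub]
  exact hA.sum_sub_sq_le hB ((sigma_antitone A j).monovary (sigma_antitone B j))
    (fun i => sigma_nonneg A i j) fun i => sigma_nonneg B i j

theorem continuous_sigma (i : Fin d) (j : ZMod d₃) :
    Continuous fun A : Tensor d d₃ => sigma A i j := by
  refine (LipschitzWith.of_dist_le_mul (K := NNReal.sqrt d₃) fun A B => ?_).continuous
  have hd : (0 : ℝ) < d₃ := Nat.cast_pos.2 (NeZero.pos d₃)
  have hsq : (sigma A i j - sigma B i j) ^ 2 ≤ d₃ * ‖A - B‖ ^ 2 :=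
    calc (sigma A i j - sigma B i j) ^ 2 ≤ ∑ j, (sigma A i j - sigma B i j) ^ 2 :=
          Finset.single_le_sum (f := fun j => (sigma A i j - sigma B i j) ^ 2)
            (fun _ _ => sq_nonneg _) (Finset.mem_univ j)
      _ ≤ ∑ i, ∑ j, (sigma A i j - sigma B i j) ^ 2 :=
          Finset.single_le_sum (f := fun i => ∑ j, (sigma A i j - sigma B i j) ^ 2)
            (fun _ _ => Finset.sum_nonneg fun _ _ => sq_nonneg _) (Finset.mem_univ i)
      _ ≤ d₃ * ‖A - B‖ ^ 2 := by
          rw [← inv_mul_le_iff₀ hd, ← one_div]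
          exact sum_sigma_sub_sq_le A B
  rw [Real.dist_eq, dist_eq_norm, Real.coe_sqrt, NNReal.coe_natCast]
  refine abs_le_of_sq_le_sq ?_ (by positivity)
  rwa [mul_pow, Real.sq_sqrt hd.le]

/-- The weighted tubal nuclear norm `(1/d₃) ∑_{i,j} w_{ij} σ_{ij}`, the linear model of the
regularizer that is minimized in each iteration. -/
noncomputable def weightedNuclearNorm (W : Fin d → ZMod d₃ → ℝ) (A : Tensor d d₃) : ℝ :=
  1 / (d₃ : ℝ) * ∑ i, ∑ j, W i j * sigma A i j

theorem half_norm_sq_add_mul_weightedNuclearNorm (W : Fin d → ZMod d₃ → ℝ) (τ : ℝ)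
    (G X : Tensor d d₃) :
    1 / 2 * ‖X - G‖ ^ 2 + τ * weightedNuclearNorm W X =
      1 / (d₃ : ℝ) * ∑ j, (1 / 2 * ‖fourierSlice X j - fourierSlice G j‖ ^ 2 +
        ∑ i : Fin d, τ * W i j * (toEuclideanLin (fourierSlice X j)).singularValues i) := by
  simp only [norm_sq_eq_sum_norm_sq_fourierSlice, fourierSlice_sub, weightedNuclearNorm,
    Finset.sum_add_distrib, mul_assoc, ← Finset.mul_sum]
  rw [Finset.sum_comm, mul_add, mul_left_comm, mul_left_comm τ]
  rfl

theorem IsWTSVT.isMinOn {G Y : Tensor d d₃} {τ : ℝ} {W : Fin d → ZMod d₃ → ℝ}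
    (h : IsWTSVT G τ W Y) (hτ : 0 ≤ τ) (hW : ∀ j, Monotone fun i => W i j) :
    IsMinOn (fun X => 1 / 2 * ‖X - G‖ ^ 2 + τ * weightedNuclearNorm W X) Set.univ Y := by
  obtain ⟨U, S, V, S', hG, ⟨hS'diag, hS'⟩, rfl⟩ := h
  simp only [hG.diagonal, Complex.ofReal_re] at hS'
  rw [isMinOn_univ_iff]
  intro X
  simp only [half_norm_sq_add_mul_weightedNuclearNorm]
  gcongr 1 / (d₃ : ℝ) * ?_
  refine Finset.sum_le_sum fun j _ => ?_
  have hGsvd : IsSVD (fourierSlice G j) (fourierSlice U j) (fun i => sigma G i j)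
      (fourierSlice V j) := by
    have h := isSVD_fourierSlice hG.orthogonal_left hG.orthogonal_right hG.fdiagonal
      fun i => hG.diagonal i j
    rwa [← hG.factorization] at h
  have hYsvd := isSVD_fourierSlice hG.orthogonal_left hG.orthogonal_right hS'diag
    fun i => hS' i j
  have hanti : Antitone ((fun i => sigma G i j) - fun i => τ * W i j) := fun i k hik =>
    sub_le_sub (sigma_antitone G j hik) (mul_le_mul_of_nonneg_left (hW j hik) hτ)
  exact isMinOn_univ_iff.1 (hGsvd.isMinOn_of_softThreshold (sigma_antitone G j)
    (fun i => sigma_nonneg G i j) hanti hYsvd) (fourierSlice X j)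

end FourierDomain

section Subdifferential

open Filter

variable {E : Type*} [NormedAddCommGroup E] [InnerProductSpace ℝ E] {f g : E → ℝ} {x v w : E}

theorem mem_frechetSubdiff_of_hasGradientAt [CompleteSpace E] (hf : HasGradientAt f v x) :
    v ∈ frechetSubdiff f x := by
  intro ε hε
  filter_upwards [(hasGradientAt_iff_isLittleO.1 hf).def hε] with y hy
  linarith [neg_le_of_abs_le hy]

theorem mem_frechetSubdiff_of_eventually_le {C : ℝ}
    (h : ∀ᶠ y in 𝓝 x, f x + inner ℝ v (y - x) - C * ‖y - x‖ ^ 2 ≤ f y) :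
    v ∈ frechetSubdiff f x := by
  intro ε hε
  have hzero : Tendsto (fun y => C * ‖y - x‖) (𝓝 x) (𝓝 0) :=
    Continuous.tendsto' (by fun_prop) _ _ (by simp)
  filter_upwards [h, hzero.eventually (gt_mem_nhds hε)] with y hy hyε
  have hquad : C * ‖y - x‖ ^ 2 ≤ ε * ‖y - x‖ := by
    rw [sq, ← mul_assoc]
    gcongr
  linarith

theorem add_mem_frechetSubdiff (hv : v ∈ frechetSubdiff f x) (hw : w ∈ frechetSubdiff g x) :
    v + w ∈ frechetSubdiff (fun y => f y + g y) x := by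
  intro ε hε
  filter_upwards [hv (ε / 2) (half_pos hε), hw (ε / 2) (half_pos hε)] with y hf hg
  rw [inner_add_left]
  linarith

theorem le_of_mem_frechetSubdiff_of_uniformConvexOn {s : Set E} {φ : ℝ → ℝ}
    (hf : UniformConvexOn s φ f) (hw : w ∈ frechetSubdiff f x) (hx : x ∈ s) {y : E} (hy : y ∈ s) :
    f x + inner ℝ w (y - x) + φ ‖x - y‖ ≤ f y := by
  have hslope (ε t : ℝ) (ht : 0 < t) (ht₁ : t ≤ 1)
      (hxt : f x + inner ℝ w (x + t • (y - x) - x) - ε * ‖x + t • (y - x) - x‖ ≤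
        f (x + t • (y - x))) :
      f x + inner ℝ w (y - x) + (1 - t) * φ ‖x - y‖ - ε * ‖y - x‖ ≤ f y := by
    have hconv := hf.2 hx hy (sub_nonneg.2 ht₁) ht.le (sub_add_cancel 1 t)
    rw [show (1 - t) • x + t • y = x + t • (y - x) by module] at hconv
    rw [add_sub_cancel_left, inner_smul_right, norm_smul, Real.norm_of_nonneg ht.le] at hxt
    simp only [smul_eq_mul] at hconv
    refine le_of_mul_le_mul_left ?_ ht
    linarith
  have heps (ε : ℝ) (hε : 0 < ε) :
      f x + inner ℝ w (y - x) + φ ‖x - y‖ - ε * ‖y - x‖ ≤ f y := by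
    have hpath : Tendsto (fun t : ℝ => x + t • (y - x)) (𝓝[>] 0) (𝓝 x) :=
      (Continuous.tendsto' (by fun_prop) _ _ (by simp)).mono_left nhdsWithin_le_nhds
    have hlim : Tendsto (fun t : ℝ => f x + inner ℝ w (y - x) + (1 - t) * φ ‖x - y‖ -
        ε * ‖y - x‖) (𝓝[>] 0) (𝓝 (f x + inner ℝ w (y - x) + φ ‖x - y‖ - ε * ‖y - x‖)) :=
      (Continuous.tendsto' (by fun_prop) _ _ (by simp)).mono_left nhdsWithin_le_nhds
    refine le_of_tendsto hlim ?_
    filter_upwards [hpath.eventually (hw ε hε), Ioc_mem_nhdsGT one_pos] with t hxt ht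
    exact hslope ε t ht.1 ht.2 hxt
  have hlim : Tendsto (fun ε : ℝ => f x + inner ℝ w (y - x) + φ ‖x - y‖ - ε * ‖y - x‖)
      (𝓝[>] 0) (𝓝 (f x + inner ℝ w (y - x) + φ ‖x - y‖)) :=
    (Continuous.tendsto' (by fun_prop) _ _ (by simp)).mono_left nhdsWithin_le_nhds
  exact le_of_tendsto hlim (eventually_mem_nhdsWithin.mono heps)

end Subdifferential

section Descent

open Filter

variable {E : Type*} [NormedAddCommGroup E]

theorem le_add_of_lipschitzWith_gradient [InnerProductSpace ℝ E] [CompleteSpace E] {L : E → ℝ}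
    (hL : Differentiable ℝ L) {K : ℝ≥0} (hLip : LipschitzWith K (gradient L)) (x y : E) :
    L y ≤ L x + inner ℝ (gradient L x) (y - x) + K / 2 * ‖y - x‖ ^ 2 := by
  set v := y - x with hv
  have hline (t : ℝ) :
      HasDerivAt (fun t => L (x + t • v)) (inner ℝ (gradient L (x + t • v)) v) t := by
    have hpath : HasDerivAt (fun t : ℝ => x + t • v) v t := by
      simpa using ((hasDerivAt_id t).smul_const v).const_add x
    exact (hL (x + t • v)).hasGradientAt.hasFDerivAt.comp_hasDerivAt t hpath
  have hmodel (t : ℝ) :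
      HasDerivAt (fun t => L x + t * inner ℝ (gradient L x) v + K / 2 * ‖v‖ ^ 2 * t ^ 2)
        (inner ℝ (gradient L x) v + K * t * ‖v‖ ^ 2) t := by
    convert! (((hasDerivAt_id t).mul_const (inner ℝ (gradient L x) v)).const_add (L x)).add
      (((hasDerivAt_id t).pow 2).const_mul (K / 2 * ‖v‖ ^ 2)) using 1
    simp only [id_eq, one_mul, mul_one, Nat.cast_ofNat]
    ring
  have hbound (t : ℝ) (ht : 0 ≤ t) : inner ℝ (gradient L (x + t • v)) v ≤
      inner ℝ (gradient L x) v + K * t * ‖v‖ ^ 2 := by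
    rw [← sub_le_iff_le_add', ← inner_sub_left]
    calc inner ℝ (gradient L (x + t • v) - gradient L x) v
        ≤ ‖gradient L (x + t • v) - gradient L x‖ * ‖v‖ := real_inner_le_norm _ _
      _ ≤ K * ‖x + t • v - x‖ * ‖v‖ := by gcongr; exact hLip.norm_sub_le _ _
      _ = K * t * ‖v‖ ^ 2 := by
        rw [add_sub_cancel_left, norm_smul, Real.norm_of_nonneg ht]
        ring
  have hle := image_le_of_deriv_right_le_deriv_boundary
    (fun t _ => (hline t).continuousAt.continuousWithinAt)
    (fun t _ => (hline t).hasDerivWithinAt) (by simp)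
    (fun t _ => (hmodel t).continuousAt.continuousWithinAt)
    (fun t _ => (hmodel t).hasDerivWithinAt) (fun t ht => hbound t ht.1)
    (Set.right_mem_Icc.2 zero_le_one)
  simpa [hv] using hle

theorem tendsto_sub_zero_of_sufficient_decrease {x : ℕ → E} {f : ℕ → ℝ} {c ℓ : ℝ} (hc : 0 < c)
    (hf : Tendsto f atTop (𝓝 ℓ))
    (hdecr : ∀ᶠ k in atTop, f (k + 1) + c * ‖x (k + 1) - x k‖ ^ 2 ≤ f k) :
    Tendsto (fun k => x (k + 1) - x k) atTop (𝓝 0) := by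
  have hgap : Tendsto (fun k => c⁻¹ * (f k - f (k + 1))) atTop (𝓝 0) := by
    simpa using (hf.sub (hf.comp (tendsto_add_atTop_nat 1))).const_mul c⁻¹
  have hsq : Tendsto (fun k => ‖x (k + 1) - x k‖ ^ 2) atTop (𝓝 0) := by
    refine squeeze_zero' (Eventually.of_forall fun k => sq_nonneg _) ?_ hgap
    filter_upwards [hdecr] with k hk
    rw [le_inv_mul_iff₀ hc]
    linarith
  rw [tendsto_zero_iff_norm_tendsto_zero]
  simpa using hsq.sqrt

theorem tendsto_of_antitone_of_mapClusterPt {α : Type*} [TopologicalSpace α]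
    [ConditionallyCompleteLinearOrder α] [OrderTopology α] [NoMinOrder α]
    [FirstCountableTopology α] {f : ℕ → α} {ℓ : α} (hf : Antitone f)
    (hℓ : MapClusterPt ℓ atTop f) : Tendsto f atTop (𝓝 ℓ) := by
  obtain ⟨ψ, hψ, hlim⟩ := hℓ.tendsto_subseq
  exact (tendsto_iff_tendsto_subseq_of_antitone hf hψ.tendsto_atTop).2 hlim

end Descent

section Reweighting

variable {d d₃ : ℕ} [NeZero d₃] {ρ : ℝ → ℝ} {A : Tensor d d₃} {W : Fin d → ZMod d₃ → ℝ}

theorem le_of_mem_frechetSubdiff_of_convexOn_add_sq {μ : ℝ} {S : Set ℝ}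
    (hconv : ConvexOn ℝ S fun x => ρ x + μ / 2 * x ^ 2) {s w : ℝ}
    (hw : w ∈ frechetSubdiff ρ s) (hs : s ∈ S) {x : ℝ} (hx : x ∈ S) :
    ρ s + w * (x - s) - μ / 2 * (x - s) ^ 2 ≤ ρ x := by
  have hstrong : StrongConvexOn S (-μ) ρ := by
    rw [strongConvexOn_iff_convex]
    simpa only [neg_div, neg_mul, sub_neg_eq_add, Real.norm_eq_abs, sq_abs] using hconv
  have hle := le_of_mem_frechetSubdiff_of_uniformConvexOn hstrong hw hs hx
  simp only [RCLike.inner_apply, conj_trivial, Real.norm_eq_abs, sq_abs] at hle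
  linarith

theorem IsWeight.le_of_le {s s' w w' : ℝ} (hs' : 0 ≤ s') (hss : s' ≤ s)
    (h : IsWeight ρ s w) (h' : IsWeight ρ s' w') : w ≤ w' := by
  rcases hss.lt_or_eq with hlt | rfl
  · have hs'w := h.2 s' hs'
    have hsw' := h'.2 s (hs'.trans hss)
    nlinarith
  · -- to the right of a point, its linear majorant lies above its subgradient minorant
    refine le_of_forall_pos_le_add fun ε hε => ?_
    have hsub : ∀ᶠ y in 𝓝[>] s', ρ s' + inner ℝ w (y - s') - ε * ‖y - s'‖ ≤ ρ y :=
      nhdsWithin_le_nhds (h.1 ε hε)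
    obtain ⟨y, hy, hlt : s' < y⟩ := (hsub.and eventually_mem_nhdsWithin).exists
    have hmaj := h'.2 y (hs'.trans hlt.le)
    rw [Real.norm_of_nonneg (sub_nonneg.2 hlt.le)] at hy
    simp only [RCLike.inner_apply, conj_trivial] at hy
    nlinarith

theorem monotone_weights (hW : ∀ i j, IsWeight ρ (sigma A i j) (W i j)) (j : ZMod d₃) :
    Monotone fun i => W i j := fun i i' hii =>
  (hW i j).le_of_le (sigma_nonneg A i' j) (sigma_antitone A j hii) (hW i' j)

theorem tensorPenalty_le (hW : ∀ i j, IsWeight ρ (sigma A i j) (W i j)) (X : Tensor d d₃) :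
    tensorPenalty ρ X ≤
      tensorPenalty ρ A + weightedNuclearNorm W X - weightedNuclearNorm W A := by
  simp only [tensorPenalty, weightedNuclearNorm, ← mul_add, ← mul_sub, ← Finset.sum_add_distrib,
    ← Finset.sum_sub_distrib]
  gcongr with i _ j
  linarith [(hW i j).2 _ (sigma_nonneg X i j)]

theorem le_tensorPenalty {μ : ℝ} (hμ : 0 ≤ μ)
    (hconv : ConvexOn ℝ (Set.Ici 0) fun x => ρ x + μ / 2 * x ^ 2)
    (hW : ∀ i j, IsWeight ρ (sigma A i j) (W i j)) (X : Tensor d d₃) :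
    tensorPenalty ρ A + weightedNuclearNorm W X - weightedNuclearNorm W A -
      μ / 2 * ‖X - A‖ ^ 2 ≤ tensorPenalty ρ X :=
  calc tensorPenalty ρ A + weightedNuclearNorm W X - weightedNuclearNorm W A - μ / 2 * ‖X - A‖ ^ 2
      ≤ tensorPenalty ρ A + weightedNuclearNorm W X - weightedNuclearNorm W A -
          μ / 2 * (1 / (d₃ : ℝ) * ∑ i, ∑ j, (sigma X i j - sigma A i j) ^ 2) := by
        gcongr
        exact sum_sigma_sub_sq_le X A
    _ ≤ tensorPenalty ρ X := by
        rw [mul_left_comm]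
        simp only [tensorPenalty, weightedNuclearNorm, ← mul_add, ← mul_sub,
          Finset.mul_sum _ _ (μ / 2), ← Finset.sum_add_distrib, ← Finset.sum_sub_distrib]
        gcongr with i _ j
        linarith [le_of_mem_frechetSubdiff_of_convexOn_add_sq hconv (hW i j).1
          (sigma_nonneg A i j) (sigma_nonneg X i j)]

theorem continuous_tensorPenalty (hρ : ContinuousOn ρ (Set.Ici 0)) :
    Continuous (tensorPenalty ρ : Tensor d d₃ → ℝ) :=
  continuous_const.mul <| continuous_finsetSum _ fun i _ => continuous_finsetSum _ fun j _ =>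
    hρ.comp_continuous (continuous_sigma i j) fun A => sigma_nonneg A i j

end Reweighting

section Update

variable {d d₃ : ℕ} [NeZero d₃] {L : Tensor d d₃ → ℝ} {ρ : ℝ → ℝ} {W : Fin d → ZMod d₃ → ℝ}
  {η : ℝ} {A Y : Tensor d d₃}

theorem half_norm_sub_sub_smul_sq {E : Type*} [NormedAddCommGroup E] [InnerProductSpace ℝ E]
    (hη : η ≠ 0) (g x z : E) :
    η * (1 / 2 * ‖z - (x - (1 / η) • g)‖ ^ 2) =
      inner ℝ g (z - x) + η / 2 * ‖z - x‖ ^ 2 + η / 2 * ‖(1 / η) • g‖ ^ 2 := by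
  rw [← sub_add, norm_add_sq_real, inner_smul_right, real_inner_comm]
  field_simp
  ring

theorem IsUpdate.isMinOn (h : IsUpdate L W η A Y) (hη : 0 < η)
    (hW : ∀ j, Monotone fun i => W i j) :
    IsMinOn (fun X => inner ℝ (gradient L A) (X - A) + η / 2 * ‖X - A‖ ^ 2 +
      weightedNuclearNorm W X) Set.univ Y := by
  rw [isMinOn_univ_iff]
  intro X
  have hmin := mul_le_mul_of_nonneg_left
    (isMinOn_univ_iff.1 (IsWTSVT.isMinOn h (by positivity) hW) X) hη.le
  simp only [mul_add, half_norm_sub_sub_smul_sq hη.ne', ← mul_assoc η (1 / η),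
    mul_one_div_cancel hη.ne', one_mul] at hmin
  linarith

theorem IsUpdate.searchCriterion (h : IsUpdate L W η A Y) (hη : 0 < η) (hL : Differentiable ℝ L)
    {K : ℝ≥0} (hLip : LipschitzWith K (gradient L)) {α : ℝ} (hα : α < 1)
    (hW : ∀ i j, IsWeight ρ (sigma A i j) (W i j)) (hK : K / (1 - α) ≤ η) :
    SearchCriterion L ρ α η A Y := by
  have hmin := isMinOn_univ_iff.1 (h.isMinOn hη (monotone_weights hW)) A
  have hpen := tensorPenalty_le hW Y
  have hdesc := le_add_of_lipschitzWith_gradient hL hLip A Y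
  have hquad : K / 2 * ‖Y - A‖ ^ 2 ≤ (η / 2 - α / 2 * η) * ‖Y - A‖ ^ 2 := by
    rw [div_le_iff₀ (sub_pos.2 hα)] at hK
    gcongr
    linarith
  rw [sub_self, inner_zero_right, norm_zero] at hmin
  unfold SearchCriterion objective
  linarith

theorem IsUpdate.le_tensorPenalty (h : IsUpdate L W η A Y) (hη : 0 < η) {μ : ℝ} (hμ : 0 ≤ μ)
    (hconv : ConvexOn ℝ (Set.Ici 0) fun x => ρ x + μ / 2 * x ^ 2)
    (hW : ∀ i j, IsWeight ρ (sigma A i j) (W i j)) (X : Tensor d d₃) :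
    tensorPenalty ρ Y + inner ℝ (-gradient L A) (X - Y) - (η + μ) / 2 * ‖X - A‖ ^ 2 ≤
      tensorPenalty ρ X := by
  have hmin := isMinOn_univ_iff.1 (h.isMinOn hη (monotone_weights hW)) X
  have hupper := tensorPenalty_le hW Y
  have hlower := TubalRegression.le_tensorPenalty hμ hconv hW X
  have hinner : inner ℝ (-gradient L A) (X - Y) =
      inner ℝ (gradient L A) (Y - A) - inner ℝ (gradient L A) (X - A) := by
    rw [← inner_sub_right, sub_sub_sub_cancel_right, inner_neg_left, ← inner_neg_right, neg_sub]
  have hquad : 0 ≤ η / 2 * ‖Y - A‖ ^ 2 := by positivity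
  linarith

theorem barzilaiBorwein_le {K : ℝ≥0} (hLip : LipschitzWith K (gradient L))
    (A' A : Tensor d d₃) : barzilaiBorwein L A' A ≤ K := by
  refine div_le_of_le_mul₀ real_inner_self_nonneg K.2 ?_
  calc inner ℝ (A - A') (gradient L A - gradient L A')
      ≤ ‖A - A'‖ * ‖gradient L A - gradient L A'‖ := real_inner_le_norm _ _
    _ ≤ ‖A - A'‖ * (K * ‖A - A'‖) := by gcongr; exact hLip.norm_sub_le A A'
    _ = K * inner ℝ (A - A') (A - A') := by rw [real_inner_self_eq_norm_sq]; ring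

end Update

namespace IsAlgorithmRun

open Filter

variable {d d₃ : ℕ} [NeZero d₃] {L : Tensor d d₃ → ℝ} {ρ : ℝ → ℝ} {α κ c : ℝ}
  {B : ℕ → Tensor d d₃} {W : ℕ → Fin d → ZMod d₃ → ℝ} {η₀ : ℕ → ℝ} {m : ℕ → ℕ}
  {Bstar : Tensor d d₃}

theorem stepParam_pos (hrun : IsAlgorithmRun L ρ α κ c B W η₀ m) (hκ : 0 < κ) (k : ℕ) :
    0 < stepParam κ η₀ m k :=
  mul_pos (pow_pos hκ _) (hrun.init_pos k)

theorem stepParam_le (hrun : IsAlgorithmRun L ρ α κ c B W η₀ m) (hL : Differentiable ℝ L)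
    {K : ℝ≥0} (hLip : LipschitzWith K (gradient L)) (hα : α < 1) (hκ : 0 < κ) {k : ℕ}
    (hk : k ≠ 0) : stepParam κ η₀ m k ≤ max (max (K : ℝ) c) (κ * (K / (1 - α))) := by
  obtain ⟨k, rfl⟩ := Nat.exists_eq_succ_of_ne_zero hk
  unfold stepParam
  rcases hm : m (k + 1) with _ | n
  · rw [pow_zero, one_mul]
    refine le_max_of_le_left ?_
    rcases hrun.init k with h | h
    · exact h ▸ le_max_of_le_left (barzilaiBorwein_le hLip _ _)
    · exact le_max_of_le_right h
  · obtain ⟨Y, hY, hnot⟩ := hrun.rejected (k + 1) n (by lia)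
    have hpos : 0 < κ ^ n * η₀ (k + 1) := mul_pos (pow_pos hκ n) (hrun.init_pos _)
    have hlt : κ ^ n * η₀ (k + 1) < K / (1 - α) := by
      by_contra! hge
      exact hnot (hY.searchCriterion hpos hL hLip hα (hrun.weights _) hge)
    rw [pow_succ', mul_assoc]
    exact le_max_of_le_right (mul_le_mul_of_nonneg_left hlt.le hκ.le)

theorem antitone_objective (hrun : IsAlgorithmRun L ρ α κ c B W η₀ m) (hα : 0 ≤ α) (hκ : 0 < κ) :
    Antitone fun k => objective L ρ (B k) :=
  antitone_nat_of_succ_le fun k => by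
    have hstep := (hrun.stepParam_pos hκ k).le
    have hdecr : 0 ≤ α / 2 * stepParam κ η₀ m k * ‖B (k + 1) - B k‖ ^ 2 := by positivity
    exact (le_add_of_nonneg_right hdecr).trans (hrun.criterion k)

theorem tendsto_sub_zero (hrun : IsAlgorithmRun L ρ α κ c B W η₀ m) (hα : 0 < α) (hκ : 0 < κ)
    {b : ℝ} (hb : 0 < b) (hη : ∀ᶠ k in atTop, b ≤ stepParam κ η₀ m k)
    (hF : ContinuousAt (objective L ρ) Bstar) (hacc : MapClusterPt Bstar atTop B) :
    Tendsto (fun k => B (k + 1) - B k) atTop (𝓝 0) := by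
  have hlim : Tendsto (fun k => objective L ρ (B k)) atTop (𝓝 (objective L ρ Bstar)) :=
    tendsto_of_antitone_of_mapClusterPt (hrun.antitone_objective hα.le hκ)
      (hacc.continuousAt_comp hF)
  refine tendsto_sub_zero_of_sufficient_decrease (show 0 < α / 2 * b by positivity) hlim ?_
  filter_upwards [hη] with k hk
  refine le_trans ?_ (hrun.criterion k)
  gcongr

theorem le_tensorPenalty_of_mapClusterPt (hrun : IsAlgorithmRun L ρ α κ c B W η₀ m) (hκ : 0 < κ)
    (hL : Continuous (gradient L)) (hρ : ContinuousOn ρ (Set.Ici 0)) {μ : ℝ} (hμ : 0 ≤ μ)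
    (hconv : ConvexOn ℝ (Set.Ici 0) fun x => ρ x + μ / 2 * x ^ 2) {M : ℝ}
    (hM : ∀ᶠ k in atTop, stepParam κ η₀ m k ≤ M)
    (hsucc : Tendsto (fun k => B (k + 1) - B k) atTop (𝓝 0))
    (hacc : MapClusterPt Bstar atTop B) (X : Tensor d d₃) :
    tensorPenalty ρ Bstar + inner ℝ (-gradient L Bstar) (X - Bstar) -
      (M + μ) / 2 * ‖X - Bstar‖ ^ 2 ≤ tensorPenalty ρ X := by
  obtain ⟨ψ, hψ, hlim⟩ := hacc.tendsto_subseq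
  have hlim' : Tendsto (fun k => B (ψ k + 1)) atTop (𝓝 Bstar) := by
    simpa using (hsucc.comp hψ.tendsto_atTop).add hlim
  have hbound : Tendsto (fun k => tensorPenalty ρ (B (ψ k + 1)) +
      inner ℝ (-gradient L (B (ψ k))) (X - B (ψ k + 1)) - (M + μ) / 2 * ‖X - B (ψ k)‖ ^ 2) atTop
      (𝓝 (tensorPenalty ρ Bstar + inner ℝ (-gradient L Bstar) (X - Bstar) -
        (M + μ) / 2 * ‖X - Bstar‖ ^ 2)) :=
    ((((continuous_tensorPenalty hρ).tendsto _).comp hlim').add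
      (((hL.tendsto _).comp hlim).neg.inner (hlim'.const_sub X))).sub
      (((hlim.const_sub X).norm.pow 2).const_mul _)
  refine le_of_tendsto hbound ?_
  filter_upwards [hψ.tendsto_atTop.eventually hM] with k hk
  refine le_trans ?_ ((hrun.update (ψ k)).le_tensorPenalty (hrun.stepParam_pos hκ _) hμ hconv
    (hrun.weights _) X)
  gcongr

end IsAlgorithmRun

end TubalRegression

open TubalRegression in
theorem mainTheorem6_general (d d₃ : ℕ) [NeZero d₃]
    (L : Tensor d d₃ → ℝ) (hL : Differentiable ℝ L)
    (Cl : ℝ≥0) (hLip : LipschitzWith Cl (gradient L))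
    (ρ : ℝ → ℝ) (hρ : ContinuousOn ρ (Set.Ici 0))
    (μ : ℝ) (hμ : 0 ≤ μ) (hconv : ConvexOn ℝ (Set.Ici 0) fun x => ρ x + μ / 2 * x ^ 2)
    (α κ c : ℝ) (hα₀ : 0 < α) (hα₁ : α < 1) (hκ : 0 < κ)
    (B : ℕ → Tensor d d₃) (W : ℕ → Fin d → ZMod d₃ → ℝ) (η₀ : ℕ → ℝ) (m : ℕ → ℕ)
    (hrun : IsAlgorithmRun L ρ α κ c B W η₀ m)
    (b : ℝ) (hb : 0 < b) (hη : ∀ᶠ k in Filter.atTop, b ≤ stepParam κ η₀ m k)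
    (Bstar : Tensor d d₃) (hacc : MapClusterPt Bstar Filter.atTop B) :
    IsStationaryPoint (objective L ρ) Bstar := by
  have hF : Continuous (objective L ρ) := hL.continuous.add (continuous_tensorPenalty hρ)
  have hsucc := hrun.tendsto_sub_zero hα₀ hκ hb hη hF.continuousAt hacc
  have hbounded := (Filter.eventually_ne_atTop 0).mono fun k hk =>
    hrun.stepParam_le hL hLip hα₁ hκ hk
  have hpenalty : -gradient L Bstar ∈ frechetSubdiff (tensorPenalty ρ) Bstar :=
    mem_frechetSubdiff_of_eventually_le <| .of_forall <|
      hrun.le_tensorPenalty_of_mapClusterPt hκ hLip.continuous hρ hμ hconv hbounded hsucc hacc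
  have hsum := add_mem_frechetSubdiff
    (mem_frechetSubdiff_of_hasGradientAt (hL Bstar).hasGradientAt) hpenalty
  rwa [add_neg_cancel] at hsum

theorem mainTheorem6 (d d₃ : ℕ) [NeZero d₃]
    (L : TubalRegression.Tensor d d₃ → ℝ) (hL : Differentiable ℝ L)
    (Cl : ℝ≥0) (hCl : 0 < Cl) (hLip : LipschitzWith Cl (gradient L))
    (ρ : ℝ → ℝ) (hρ : TubalRegression.IsPenalty ρ) (hρ' : TubalRegression.PenaltyAssumption ρ)
    (α κ c : ℝ) (hα₀ : 0 < α) (hα₁ : α < 1) (hκ : 1 < κ)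
    (B : ℕ → TubalRegression.Tensor d d₃) (W : ℕ → Fin d → ZMod d₃ → ℝ)
    (η₀ : ℕ → ℝ) (m : ℕ → ℕ)
    (hrun : TubalRegression.IsAlgorithmRun L ρ α κ c B W η₀ m)
    (hη : ∀ k, 0 < k → (Cl : ℝ) / (1 - α) ≤ TubalRegression.stepParam κ η₀ m k)
    (hF : TubalRegression.IsCoerciveFun (TubalRegression.objective L ρ))
    (Bstar : TubalRegression.Tensor d d₃)
    (hacc : MapClusterPt Bstar Filter.atTop B) :
    TubalRegression.IsStationaryPoint (TubalRegression.objective L ρ) Bstar := by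
  obtain ⟨μ, hμ, hconv⟩ := hρ'.weaklyConvex
  exact mainTheorem6_general d d₃ L hL Cl hLip ρ hρ.continuousOn μ hμ.le
    (hconv.subset (Set.subset_univ _) (convex_Ici 0)) α κ c hα₀ hα₁ (one_pos.trans hκ) B W η₀ m hrun
    (Cl / (1 - α)) (div_pos hCl (sub_pos.2 hα₁))
    ((Filter.eventually_gt_atTop 0).mono hη) Bstar hacc
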